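/- Let $G=(V,E)$ be a finite connected graph, possibly with loops and multiple edges. Identify each edge of $G$ with the interval $[0,1]$ (its ends being glued at the vertices), so that $G$ becomes a topological space, a subset being closed when its intersection with each edge is closed, and a measure space $(G,\mu_G)$, where $\mu_G$ is the sum over the edges of Lebesgue measure on $[0,1]$. For $r\in(0,|E|)$ let $X_r(G)$ be the set of all closed connected subsets $u\subseteq G$ with $\mu_G(u)=r$. Then $$d_G(u,v)=2r-2\mu_G(u\cap v),\qquad u,v\in X_r(G),$$ is a metric on $X_r(G)$, and the metric space $(X_r(G),d_G)$ is path-connected (in particular nonempty). -/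

import Mathlib

open MeasureTheory

/-- A multigraph (loops and parallel edges allowed) is connected if it has a vertex and any two of
its vertices are joined by a walk. -/
def Graph.IsConn {α β : Type*} (G : Graph α β) : Prop :=
  G.vertexSet.Nonempty ∧
    ∀ x ∈ G.vertexSet, ∀ y ∈ G.vertexSet, Relation.ReflTransGen G.Adj x y

/-- A choice, for each edge of `G`, of the direction in which the edge is identified with `[0,1]`:
the end `src e` corresponds to `0` and the end `tgt e` corresponds to `1`. -/
structure Graph.EdgeParam {α β : Type*} (G : Graph α β) where
  /-- The end of the edge placed at `0`. -/
  src : G.edgeSet → G.vertexSet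
  /-- The end of the edge placed at `1`. -/
  tgt : G.edgeSet → G.vertexSet
  /-- These two vertices are the ends of the edge. -/
  isLink : ∀ e : G.edgeSet, G.IsLink e (src e) (tgt e)

namespace Graph.EdgeParam

/-- The points of the graph `G` with its edges identified with `[0,1]`: the vertices, together
with the points `t ∈ (0,1)` in the interior of each edge. -/
inductive Point {α β : Type*} {G : Graph α β} (p : G.EdgeParam) where
  /-- A vertex. -/
  | vertex (v : G.vertexSet) : Point p
  /-- An interior point of an edge. -/
  | interior (e : G.edgeSet) (t : Set.Ioo (0 : ℝ) 1) : Point p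

open Classical in
/-- The identification of `[0,1]` with the (closed) edge `e`. -/
noncomputable def edgeMap {α β : Type*} {G : Graph α β} (p : G.EdgeParam) (e : G.edgeSet)
    (t : unitInterval) : p.Point :=
  if h : 0 < (t : ℝ) ∧ (t : ℝ) < 1 then .interior e ⟨t, h⟩
  else if (t : ℝ) = 0 then .vertex (p.src e) else .vertex (p.tgt e)

/-- A set of points is open (closed) iff its intersection with each edge is open (closed) in
that edge. -/
noncomputable instance instTopologicalSpacePoint {α β : Type*} {G : Graph α β} (p : G.EdgeParam) :
    TopologicalSpace p.Point :=
  ⨆ e : G.edgeSet, TopologicalSpace.coinduced (p.edgeMap e) inferInstance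

theorem isClosed_iff {α β : Type*} {G : Graph α β} (p : G.EdgeParam) (s : Set p.Point) :
    IsClosed s ↔ ∀ e, IsClosed (p.edgeMap e ⁻¹' s) := by
  rw [isClosed_iSup_iff]
  exact forall_congr' fun e => isClosed_coinduced

theorem continuous_edgeMap {α β : Type*} {G : Graph α β} (p : G.EdgeParam) (e : G.edgeSet) :
    Continuous (p.edgeMap e) :=
  continuous_iff_isClosed.2 fun s hs => (p.isClosed_iff s).1 hs e

/-- The Borel σ-algebra. -/
noncomputable instance instMeasurableSpacePoint {α β : Type*} {G : Graph α β} (p : G.EdgeParam) :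
    MeasurableSpace p.Point :=
  borel p.Point

instance instBorelSpacePoint {α β : Type*} {G : Graph α β} (p : G.EdgeParam) :
    BorelSpace p.Point :=
  ⟨rfl⟩

/-- The measure `μ_G`: the sum over the edges of Lebesgue measure on `[0,1]`. -/
noncomputable def measure {α β : Type*} {G : Graph α β} (p : G.EdgeParam) : Measure p.Point :=
  Measure.sum fun e : G.edgeSet => (volume : Measure unitInterval).map (p.edgeMap e)

theorem measure_apply {α β : Type*} {G : Graph α β} (p : G.EdgeParam) {s : Set p.Point}
    (hs : MeasurableSet s) :
    p.measure s = ∑' e : G.edgeSet, (volume : Measure unitInterval) (p.edgeMap e ⁻¹' s) := by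
  rw [measure, Measure.sum_apply _ hs]
  exact tsum_congr fun e => Measure.map_apply (p.continuous_edgeMap e).measurable hs

/-- The space `X_r(G)` of closed connected subsets of `G` of measure `r`. -/
structure ConnSet {α β : Type*} {G : Graph α β} (p : G.EdgeParam) (r : ℝ) where
  /-- The underlying set of points. -/
  carrier : Set p.Point
  isClosed : IsClosed carrier
  isConnected : IsConnected carrier
  measure_eq : p.measure.real carrier = r

end Graph.EdgeParam

/-! Everything rests on growths: a closed connected set is swept out from one of its points by
closed connected sets whose measure is Lipschitz in time. A closed connected subset of a finite
graph is a finite union of segments and vertices (`exists_pieces`), and such a union grows from each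
of its points (`nonempty_growth_sUnion`).

If u and v share a point x, u is shrunk backwards along a growth from x while a growth of v from x
fills in the missing measure. The intermediate value theorem keeps the measure equal to r, and the
resulting path is Lipschitz (`joined_of_mem`). For arbitrary u and v, a segment of length at most r
lies in some member of X_r, so the statement "every member through z is joined to u" passes from z
to nearby points of the same edge, hence along edges and through the connected graph.

The triangle inequality is inclusion-exclusion inside the middle set. Definiteness holds because a
connected union of pieces of positive measure has no isolated point, so a closed set containing
almost all of it contains it (`subset_of_measure_diff_eq_zero`). -/

/-- A growth of `S` from the point `x`: an increasing family of closed connected subsets of `S`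
containing `x`, indexed by time, starting at time `0`, exhausting `S`, and whose measure increases
at a bounded rate. In particular the member at time `0` is a null set. -/
structure Growth {X : Type*} [TopologicalSpace X] [MeasurableSpace X] (μ : Measure X)
    (x : X) (S : Set X) where
  /-- The set grown by time `t`. -/
  toFun : ℝ → Set X
  /-- The time at which everything is grown. -/
  time : ℝ
  /-- A bound for the growth rate of the measure. -/
  rate : ℝ
  mono : Monotone toFun
  isClosed : ∀ t, IsClosed (toFun t)
  isPreconnected : ∀ t, IsPreconnected (toFun t)
  eq_empty : ∀ t < 0, toFun t = ∅
  mem : ∀ t, 0 ≤ t → x ∈ toFun t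
  subset : ∀ t, toFun t ⊆ S
  subset_time : S ⊆ toFun time
  measure_diff_le : ∀ s t, s ≤ t → μ.real (toFun t \ toFun s) ≤ rate * (t - s)

/-! ### Growths in a measured topological space -/

namespace Growth

variable {X : Type*} [TopologicalSpace X] [MeasurableSpace X] {μ : Measure X}
  {x y : X} {S T N : Set X}

theorem toFun_time (A : Growth μ x S) : A.toFun A.time = S :=
  (A.subset _).antisymm A.subset_time

theorem rate_nonneg (A : Growth μ x S) : 0 ≤ A.rate := by
  have := A.measure_diff_le 0 1 zero_le_one
  have h := measureReal_nonneg (μ := μ) (s := A.toFun 1 \ A.toFun 0)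
  linarith

theorem time_nonneg (A : Growth μ x S) (h : S.Nonempty) : 0 ≤ A.time := by
  by_contra! hlt
  have := A.toFun_time
  rw [A.eq_empty _ hlt] at this
  simp [← this] at h

theorem measureReal_toFun_zero (A : Growth μ x S) : μ.real (A.toFun 0) = 0 := by
  refine le_antisymm (le_of_forall_pos_le_add fun ε hε => ?_) measureReal_nonneg
  have hp : 0 < A.rate + 1 := by linarith [A.rate_nonneg]
  -- Compare with a slightly negative time, when the set is still empty; the `+ 1` avoids dividing
  -- by a zero rate.
  have hq : 0 < ε / (A.rate + 1) := by positivity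
  have h1 := A.measure_diff_le (-(ε / (A.rate + 1))) 0 (by linarith)
  rw [A.eq_empty (-(ε / (A.rate + 1))) (by linarith), Set.sdiff_empty] at h1
  have : (A.rate + 1) * (ε / (A.rate + 1)) = ε := by field_simp
  nlinarith

/-- A closed null point grows from itself. -/
def singleton (x : X) (hx : IsClosed {x}) (h0 : μ {x} = 0) : Growth μ x {x} where
  toFun t := {y | y = x ∧ 0 ≤ t}
  time := 0
  rate := 0
  mono s t hst y hy := ⟨hy.1, hy.2.trans hst⟩
  isClosed t := by
    by_cases ht : 0 ≤ t
    · simpa [ht] using hx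
    · simp [ht]
  isPreconnected t := Set.Subsingleton.isPreconnected fun a ha b hb => ha.1.trans hb.1.symm
  eq_empty t ht := by simp [not_le.2 ht]
  mem t ht := ⟨rfl, ht⟩
  subset t y hy := hy.1
  subset_time y hy := ⟨hy, le_rfl⟩
  measure_diff_le s t hst := by
    have : μ ({y | y = x ∧ 0 ≤ t} \ {y | y = x ∧ 0 ≤ s}) = 0 :=
      measure_mono_null (fun y hy => hy.1.1) h0
    simp [measureReal_def, this]

theorem isPreconnected_union (A : Growth μ x S) (hN : IsPreconnected N) (hx : x ∈ N) (t : ℝ) :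
    IsPreconnected (N ∪ A.toFun t) := by
  rcases lt_or_ge t 0 with h | h
  · simpa [A.eq_empty t h] using hN
  · exact hN.union x hx (A.mem t h) (A.isPreconnected t)

variable [IsFiniteMeasure μ]

/-- First grow `S` from `x`, then grow `T` from a point of `S`. -/
def union (A : Growth μ x S) (B : Growth μ y T) (hy : y ∈ S) :
    Growth μ x (S ∪ T) where
  toFun t := A.toFun t ∪ B.toFun (t - A.time)
  time := A.time + max B.time 0
  rate := A.rate + B.rate
  mono s t hst := Set.union_subset_union (A.mono hst) (B.mono (by linarith))
  isClosed t := (A.isClosed t).union (B.isClosed _)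
  isPreconnected t := by
    rcases lt_or_ge t A.time with h | h
    · rw [B.eq_empty _ (by linarith), Set.union_empty]
      exact A.isPreconnected t
    · exact (A.isPreconnected t).union y (A.mono h (A.subset_time hy)) (B.mem _ (by linarith))
        (B.isPreconnected _)
  eq_empty t ht := by
    rw [A.eq_empty t ht, B.eq_empty _ (by linarith [A.time_nonneg ⟨y, hy⟩]), Set.union_empty]
  mem t ht := Or.inl (A.mem t ht)
  subset t := Set.union_subset_union (A.subset _) (B.subset _)
  subset_time := Set.union_subset_union
    (A.subset_time.trans (A.mono (by simp))) (B.subset_time.trans (B.mono (by simp)))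
  measure_diff_le s t hst := by
    have h : (A.toFun t ∪ B.toFun (t - A.time)) \ (A.toFun s ∪ B.toFun (s - A.time)) ⊆
        (A.toFun t \ A.toFun s) ∪ (B.toFun (t - A.time) \ B.toFun (s - A.time)) := by
      rintro z ⟨hz | hz, hz'⟩
      · exact Or.inl ⟨hz, fun h => hz' (Or.inl h)⟩
      · exact Or.inr ⟨hz, fun h => hz' (Or.inr h)⟩
    have h1 := measureReal_mono (μ := μ) h
    have h2 := measureReal_union_le (μ := μ) (A.toFun t \ A.toFun s)
      (B.toFun (t - A.time) \ B.toFun (s - A.time))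
    have h3 := A.measure_diff_le s t hst
    have h4 := B.measure_diff_le (s - A.time) (t - A.time) (by linarith)
    linarith

theorem measureReal_union_le_add (A : Growth μ x S) (N : Set X) {s t : ℝ} (hst : s ≤ t) :
    μ.real (N ∪ A.toFun t) ≤ μ.real (N ∪ A.toFun s) + A.rate * (t - s) := by
  have h : N ∪ A.toFun t ⊆ (N ∪ A.toFun s) ∪ (A.toFun t \ A.toFun s) := by
    intro z hz
    by_cases hs : z ∈ A.toFun s
    · exact Or.inl (Or.inr hs)
    · exact hz.imp Or.inl fun h => ⟨h, hs⟩
  have h1 := measureReal_mono (μ := μ) h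
  have h2 := measureReal_union_le (μ := μ) (N ∪ A.toFun s) (A.toFun t \ A.toFun s)
  have h3 := A.measure_diff_le s t hst
  linarith

theorem continuous_measureReal_union (A : Growth μ x S) (N : Set X) :
    Continuous fun t => μ.real (N ∪ A.toFun t) := by
  have key : LipschitzWith A.rate.toNNReal fun t => μ.real (N ∪ A.toFun t) := by
    refine LipschitzWith.of_le_add_mul _ fun s t => ?_
    rw [Real.coe_toNNReal _ A.rate_nonneg, Real.dist_eq]
    rcases le_total s t with h | h
    · have h1 := measureReal_mono (μ := μ) (Set.union_subset_union_right N (A.mono h))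
      have h2 := mul_nonneg A.rate_nonneg (abs_nonneg (s - t))
      linarith
    · rw [abs_of_nonneg (by linarith)]
      exact A.measureReal_union_le_add N h
  exact key.continuous

theorem exists_measureReal_union_eq (A : Growth μ x S) {r : ℝ} (hN : μ.real N ≤ r)
    (hS : r ≤ μ.real S) : ∃ t, μ.real (N ∪ A.toFun t) = r := by
  have h := intermediate_value_univ (-1) A.time (A.continuous_measureReal_union N)
  refine h ⟨?_, hS.trans (measureReal_mono ?_)⟩
  · simpa [A.eq_empty (-1) (by norm_num)] using hN
  · exact A.subset_time.trans Set.subset_union_right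

end Growth

/-! ### Connected finite unions of pieces -/

section Pieces

variable {X : Type*} [TopologicalSpace X] [MeasurableSpace X]

/-- A closed set that grows from each of its points and is either at most a point or such that its
nonempty relatively open subsets have positive measure. -/
structure IsGrowthPiece (μ : Measure X) (P : Set X) : Prop where
  isClosed : IsClosed P
  growth : ∀ x ∈ P, Nonempty (Growth μ x P)
  subsingleton_or : P.Subsingleton ∨ ∀ U, IsOpen U → (P ∩ U).Nonempty → 0 < μ (P ∩ U)

variable {μ : Measure X}

theorem isClosed_sUnion_pieces {F : Set (Set X)} (hfinF : F.Finite)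
    (hp : ∀ P ∈ F, IsGrowthPiece μ P) : IsClosed (⋃₀ F) := by
  rw [Set.sUnion_eq_biUnion]
  exact hfinF.isClosed_biUnion fun P hP => (hp P hP).isClosed

variable [IsFiniteMeasure μ]

/-- A connected finite union of pieces grows from each of its points. -/
theorem nonempty_growth_sUnion {F : Set (Set X)} (hfinF : F.Finite)
    (hp : ∀ P ∈ F, IsGrowthPiece μ P) (hc : IsPreconnected (⋃₀ F)) {x : X} (hx : x ∈ ⋃₀ F) :
    Nonempty (Growth μ x (⋃₀ F)) := by
  have hfin : {Q : Set (Set X) | Q ⊆ F ∧ Nonempty (Growth μ x (⋃₀ Q)) ∧ x ∈ ⋃₀ Q}.Finite :=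
    hfinF.finite_subsets.subset fun Q h => h.1
  obtain ⟨P₀, hP₀, hxP₀⟩ := hx
  have hne : {Q : Set (Set X) | Q ⊆ F ∧ Nonempty (Growth μ x (⋃₀ Q)) ∧ x ∈ ⋃₀ Q}.Nonempty :=
    ⟨{P₀}, by simpa using hP₀, by simpa using (hp P₀ hP₀).growth x hxP₀, by simpa using hxP₀⟩
  -- In a maximal subfamily whose union grows from `x`, any further piece meeting that union could
  -- be grown next. So the remaining pieces are disjoint from it, and connectedness leaves nothing
  -- outside.
  obtain ⟨Q, hmax⟩ := hfin.exists_maximal hne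
  obtain ⟨hsub, ⟨A⟩, hxQ⟩ := hmax.prop
  have hdisj : ∀ P ∈ F, P ∉ Q → Disjoint (⋃₀ Q) P := by
    intro P hP hPQ
    rw [Set.disjoint_left]
    intro y hy hyP
    obtain ⟨B⟩ := (hp P hP).growth y hyP
    refine hPQ (hmax.le_of_ge (y := insert P Q) ⟨Set.insert_subset hP hsub, ?_, ?_⟩
      (Set.subset_insert _ _) (Set.mem_insert _ _))
    · rw [Set.sUnion_insert, Set.union_comm]
      exact ⟨A.union B hy⟩
    · exact Set.sUnion_mono (Set.subset_insert _ _) hxQ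
  have hcover : ⋃₀ F ⊆ ⋃₀ Q ∪ ⋃₀ (F \ Q) := by
    rw [← Set.sUnion_union, Set.union_sdiff_cancel hsub]
  have hdis : Disjoint (⋃₀ Q) (⋃₀ (F \ Q)) :=
    Set.disjoint_sUnion_right.2 fun P hP => hdisj P hP.1 hP.2
  have hsubQ : ⋃₀ F ⊆ ⋃₀ Q := by
    rcases isPreconnected_iff_subset_of_disjoint_closed.1 hc _ _
      (isClosed_sUnion_pieces (hfinF.subset hsub) fun P hP => hp P (hsub hP))
      (isClosed_sUnion_pieces (hfinF.subset Set.sdiff_subset) fun P hP => hp P hP.1) hcover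
      (by rw [hdis.inter_eq, Set.inter_empty]) with h | h
    · exact h
    · exact absurd (h ⟨P₀, hP₀, hxP₀⟩) (Set.disjoint_left.1 hdis hxQ)
  rw [hsubQ.antisymm (Set.sUnion_mono hsub)]
  exact ⟨A⟩

theorem IsGrowthPiece.measure_eq_zero {P : Set X} (hP : IsGrowthPiece μ P)
    (hs : P.Subsingleton) : μ P = 0 := by
  rcases P.eq_empty_or_nonempty with rfl | ⟨x, hx⟩
  · simp
  · obtain ⟨A⟩ := hP.growth x hx
    have h := A.measureReal_toFun_zero
    rw [measureReal_eq_zero_iff] at h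
    exact measure_mono_null (fun y hy => by rw [hs hy hx]; exact A.mem 0 le_rfl) h

/-- A connected finite union of pieces of positive measure is contained in every closed set that
contains almost all of it. -/
theorem subset_of_measure_diff_eq_zero {F : Set (Set X)} (hfinF : F.Finite)
    (hp : ∀ P ∈ F, IsGrowthPiece μ P) (hc : IsPreconnected (⋃₀ F)) (hpos : 0 < μ (⋃₀ F))
    {v : Set X} (hv : IsClosed v) (h0 : μ (⋃₀ F \ v) = 0) : ⋃₀ F ⊆ v := by
  intro y hy
  by_contra hyv
  -- Otherwise `P \ v` would be a nonempty relatively open subset of `P`, of positive measure.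
  have hsing : ∀ P ∈ F, y ∈ P → P.Subsingleton := by
    intro P hP hyP
    refine (hp P hP).subsingleton_or.resolve_right fun h => ?_
    refine (h vᶜ hv.isOpen_compl ⟨y, hyP, hyv⟩).ne' (measure_mono_null ?_ h0)
    exact fun z hz => ⟨⟨P, hP, hz.1⟩, hz.2⟩
  have hcl : ∀ (p : Set X → Prop), IsClosed (⋃₀ {P ∈ F | p P}) := fun p =>
    isClosed_sUnion_pieces (hfinF.subset (Set.sep_subset _ _)) fun P hP => hp P hP.1
  -- The pieces through `y` reduce to the point `y`, which the others miss: `y` is isolated, so by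
  -- connectedness the union is the null set `{y}`.
  have hcover : ⋃₀ F ⊆ ⋃₀ {P ∈ F | y ∈ P} ∪ ⋃₀ {P ∈ F | y ∉ P} := by
    rintro z ⟨P, hP, hz⟩
    by_cases h : y ∈ P
    · exact Or.inl ⟨P, ⟨hP, h⟩, hz⟩
    · exact Or.inr ⟨P, ⟨hP, h⟩, hz⟩
  have hyy : ∀ z ∈ ⋃₀ {P ∈ F | y ∈ P}, z = y := by
    rintro z ⟨P, ⟨hP, hyP⟩, hz⟩
    exact hsing P hP hyP hz hyP
  have hyn : y ∉ ⋃₀ {P ∈ F | y ∉ P} := by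
    rintro ⟨P, ⟨-, h⟩, h'⟩
    exact h h'
  rcases isPreconnected_iff_subset_of_disjoint_closed.1 hc _ _ (hcl (y ∈ ·)) (hcl (y ∉ ·)) hcover
    (by
      rw [Set.eq_empty_iff_forall_notMem]
      rintro z ⟨-, h1, h2⟩
      rw [hyy z h1] at h2
      exact hyn h2) with h | h
  · obtain ⟨P, hP, hyP⟩ := hy
    refine hpos.ne' (measure_mono_null (fun z hz => ?_)
      ((hp P hP).measure_eq_zero (hsing P hP hyP)))
    rw [hyy z (h hz)]
    exact hyP
  · exact hyn (h hy)

end Pieces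

/-! ### Topology and measure along an edge -/

namespace Graph.EdgeParam

variable {α β : Type*} {G : Graph α β} (p : G.EdgeParam)

/-- The edge `e` parametrized by the real line, constant outside `[0,1]`. -/
noncomputable def line (e : G.edgeSet) (t : ℝ) : p.Point :=
  p.edgeMap e (Set.projIcc 0 1 zero_le_one t)

theorem continuous_line (e : G.edgeSet) : Continuous (p.line e) :=
  (p.continuous_edgeMap e).comp continuous_projIcc

theorem line_coe (e : G.edgeSet) (t : unitInterval) : p.line e t = p.edgeMap e t := by
  rw [line, Set.projIcc_val]

theorem line_zero (e : G.edgeSet) : p.line e 0 = .vertex (p.src e) := by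
  simp [line, edgeMap]

theorem line_one (e : G.edgeSet) : p.line e 1 = .vertex (p.tgt e) := by
  simp [line, edgeMap]

theorem line_of_mem_Ioo (e : G.edgeSet) (t : Set.Ioo (0 : ℝ) 1) :
    p.line e t = .interior e t := by
  have h := line_coe p e ⟨t, t.2.1.le, t.2.2.le⟩
  have h2 := t.2
  simp only [Set.mem_Ioo] at h2
  simpa [edgeMap, h2] using h

theorem line_eq_line {e e' : G.edgeSet} {s t : ℝ} (hs : s ∈ Set.Ioo (0 : ℝ) 1)
    (ht : t ∈ Set.Icc (0 : ℝ) 1) (h : p.line e s = p.line e' t) : e = e' ∧ s = t := by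
  rw [p.line_of_mem_Ioo e ⟨s, hs⟩] at h
  rcases ht.1.eq_or_lt with rfl | h0
  · rw [line_zero] at h
    cases h
  rcases ht.2.eq_or_lt with rfl | h1
  · rw [line_one] at h
    cases h
  rw [p.line_of_mem_Ioo e' ⟨t, h0, h1⟩] at h
  cases h
  exact ⟨rfl, rfl⟩

theorem line_ne_vertex {e : G.edgeSet} {s : ℝ} (hs : s ∈ Set.Ioo (0 : ℝ) 1) (v : G.vertexSet) :
    p.line e s ≠ .vertex v := by
  rw [p.line_of_mem_Ioo e ⟨s, hs⟩]
  exact fun h => by cases h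

theorem eq_zero_or_one_or_mem_Ioo (s : unitInterval) :
    s = 0 ∨ s = 1 ∨ (s : ℝ) ∈ Set.Ioo (0 : ℝ) 1 := by
  by_cases h0 : s = 0
  · exact Or.inl h0
  by_cases h1 : s = 1
  · exact Or.inr (Or.inl h1)
  · exact Or.inr (Or.inr ⟨unitInterval.pos_iff_ne_zero.2 h0, unitInterval.lt_one_iff_ne_one.2 h1⟩)

/-- Distinct edges, or the two ends of a loop, can share a vertex, so the trace on `e'` is
controlled only up to its endpoints. These form a finite null set, harmless for closedness and for
measure. -/
theorem edgeMap_preimage_line_image_subset {e e' : G.edgeSet} {S : Set ℝ}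
    (hS : S ⊆ Set.Icc 0 1) :
    p.edgeMap e' ⁻¹' (p.line e '' S) ⊆ {s | e' = e ∧ (s : ℝ) ∈ S} ∪ {0, 1} := by
  rintro s ⟨t, ht, hst⟩
  rcases eq_zero_or_one_or_mem_Ioo s with h | h | h
  · exact Or.inr (Or.inl h)
  · exact Or.inr (Or.inr h)
  · rw [← p.line_coe] at hst
    obtain ⟨rfl, rfl⟩ := p.line_eq_line h (hS ht) hst.symm
    exact Or.inl ⟨rfl, ht⟩

theorem isClosed_line_image (e : G.edgeSet) {S : Set ℝ} (hS : S ⊆ Set.Icc 0 1)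
    (hc : IsClosed S) : IsClosed (p.line e '' S) := by
  rw [isClosed_iff]
  intro e'
  have h : p.edgeMap e' ⁻¹' (p.line e '' S) = {s : unitInterval | e' = e ∧ (s : ℝ) ∈ S} ∪
      (p.edgeMap e' ⁻¹' (p.line e '' S) ∩ {0, 1} : Set unitInterval) := by
    ext s
    constructor
    · intro hs
      exact (p.edgeMap_preimage_line_image_subset hS hs).imp id fun h => ⟨hs, h⟩
    · rintro (⟨rfl, hs⟩ | hs)
      · exact ⟨s, hs, p.line_coe _ s⟩
      · exact hs.1
  rw [h]
  refine IsClosed.union ?_ (((Set.finite_singleton _).insert _).inter_of_right _).isClosed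
  by_cases he : e' = e
  · simp only [he, true_and]
    exact hc.preimage continuous_subtype_val
  · simp [he]

theorem isOpen_line_image_Ioo (e : G.edgeSet) {a b : ℝ} (ha : 0 ≤ a) (hb : b ≤ 1) :
    IsOpen (p.line e '' Set.Ioo a b) := by
  rw [isOpen_iSup_iff]
  intro e'
  rw [isOpen_coinduced]
  have h : p.edgeMap e' ⁻¹' (p.line e '' Set.Ioo a b) =
      {s : unitInterval | e' = e ∧ (s : ℝ) ∈ Set.Ioo a b} := by
    ext s
    constructor
    · rintro ⟨t, ht, hst⟩
      rw [← p.line_coe] at hst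
      obtain ⟨rfl, rfl⟩ := p.line_eq_line ⟨ha.trans_lt ht.1, ht.2.trans_le hb⟩ s.2 hst
      exact ⟨rfl, ht⟩
    · rintro ⟨rfl, hs⟩
      exact ⟨s, hs, p.line_coe _ s⟩
  rw [h]
  by_cases he : e' = e
  · simp only [he, true_and]
    exact isOpen_Ioo.preimage continuous_subtype_val
  · simp [he]

theorem edgeMap_preimage_vertex_subset (e : G.edgeSet) (v : G.vertexSet) :
    p.edgeMap e ⁻¹' {.vertex v} ⊆ {0, 1} := by
  intro s hs
  rcases eq_zero_or_one_or_mem_Ioo s with h | h | h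
  · exact Or.inl h
  · exact Or.inr h
  · rw [Set.mem_preimage, ← p.line_coe] at hs
    exact absurd hs (p.line_ne_vertex h v)

theorem isClosed_vertex (v : G.vertexSet) : IsClosed ({.vertex v} : Set p.Point) := by
  rw [isClosed_iff]
  exact fun e => (((Set.finite_singleton _).insert _).subset
    (p.edgeMap_preimage_vertex_subset e v)).isClosed

theorem volume_endpoints : volume ({0, 1} : Set unitInterval) = 0 :=
  ((Set.finite_singleton _).insert _).measure_zero _

theorem measure_vertex (v : G.vertexSet) : p.measure {.vertex v} = 0 := by
  rw [p.measure_apply (p.isClosed_vertex v).measurableSet, ENNReal.tsum_eq_zero]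
  exact fun e => measure_mono_null (p.edgeMap_preimage_vertex_subset e v) volume_endpoints

theorem measure_line_image_Icc_le (e : G.edgeSet) {a b : ℝ} (ha : 0 ≤ a) (hb : b ≤ 1) :
    p.measure (p.line e '' Set.Icc a b) ≤ ENNReal.ofReal (b - a) := by
  have hS : Set.Icc a b ⊆ Set.Icc 0 1 := Set.Icc_subset_Icc ha hb
  rw [p.measure_apply (p.isClosed_line_image e hS isClosed_Icc).measurableSet, tsum_eq_single e]
  · refine (measure_mono (p.edgeMap_preimage_line_image_subset hS)).trans
      ((measure_union_le _ _).trans ?_)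
    rw [volume_endpoints, add_zero, unitInterval.volume_apply, ← Real.volume_Icc]
    refine measure_mono ?_
    rintro _ ⟨s, hs, rfl⟩
    exact hs.2
  · intro e' he'
    refine measure_mono_null (p.edgeMap_preimage_line_image_subset hS) ?_
    simpa [he'] using volume_endpoints

theorem isFiniteMeasure_measure (hE : G.edgeSet.Finite) : IsFiniteMeasure p.measure := by
  have := hE.fintype
  constructor
  rw [p.measure_apply MeasurableSet.univ, tsum_fintype]
  simp

theorem measure_real_univ (hE : G.edgeSet.Finite) :
    p.measure.real Set.univ = (G.edgeSet.ncard : ℝ) := by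
  have := hE.fintype
  rw [measureReal_def, p.measure_apply MeasurableSet.univ, tsum_fintype]
  simp [-Set.fintypeCard_eq_ncard, ← Set.toFinset_card, ← Set.ncard_eq_toFinset_card']

/-- A segment of an edge grows from each of its points at rate at most two. -/
noncomputable def segmentGrowth (hE : G.edgeSet.Finite) (e : G.edgeSet) {a b c : ℝ} (ha : 0 ≤ a)
    (hb : b ≤ 1) (hc : c ∈ Set.Icc a b) :
    Growth p.measure (p.line e c) (p.line e '' Set.Icc a b) where
  toFun t := p.line e '' (Set.Icc a b ∩ Set.Icc (c - t) (c + t))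
  -- Points of `[0,1]` are at distance at most 1; the rate is 2 because both ends of the segment may
  -- advance.
  time := 1
  rate := 2
  mono s t hst := Set.image_mono (Set.inter_subset_inter_right _
    (Set.Icc_subset_Icc (by linarith) (by linarith)))
  isClosed t := p.isClosed_line_image e
    (Set.inter_subset_left.trans (Set.Icc_subset_Icc ha hb)) (isClosed_Icc.inter isClosed_Icc)
  isPreconnected t := by
    rw [Set.Icc_inter_Icc]
    exact isPreconnected_Icc.image _ (p.continuous_line e).continuousOn
  eq_empty t ht := by
    rw [Set.Icc_eq_empty (a := c - t) (by linarith)]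
    simp
  mem t ht := ⟨c, ⟨hc, by constructor <;> linarith⟩, rfl⟩
  subset t := Set.image_mono Set.inter_subset_left
  subset_time := by
    refine Set.image_mono fun x hx => ⟨hx, ?_⟩
    constructor <;> linarith [hx.1, hx.2, hc.1, hc.2]
  measure_diff_le s t hst := by
    have := p.isFiniteMeasure_measure hE
    have hle : ∀ c d, c ≤ d → p.measure.real (p.line e '' (Set.Icc a b ∩ Set.Icc c d)) ≤ d - c := by
      intro c d hcd
      rw [Set.Icc_inter_Icc]
      refine ENNReal.toReal_le_of_le_ofReal (by linarith)
        ((p.measure_line_image_Icc_le e (ha.trans le_sup_left) (inf_le_left.trans hb)).trans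
          (ENNReal.ofReal_le_ofReal ?_))
      linarith [le_sup_right (a := a) (b := c), inf_le_right (a := b) (b := d)]
    have hsub : p.line e '' (Set.Icc a b ∩ Set.Icc (c - t) (c + t)) \
        p.line e '' (Set.Icc a b ∩ Set.Icc (c - s) (c + s)) ⊆
        p.line e '' (Set.Icc a b ∩ Set.Icc (c - t) (c - s)) ∪
          p.line e '' (Set.Icc a b ∩ Set.Icc (c + s) (c + t)) := by
      rintro _ ⟨⟨x, ⟨hx, hx1, hx2⟩, rfl⟩, hxn⟩
      rcases lt_or_ge x (c - s) with h | h
      · exact Or.inl ⟨x, ⟨hx, hx1, h.le⟩, rfl⟩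
      rcases lt_or_ge (c + s) x with h' | h'
      · exact Or.inr ⟨x, ⟨hx, h'.le, hx2⟩, rfl⟩
      · exact absurd ⟨x, ⟨hx, h, h'⟩, rfl⟩ hxn
    refine (measureReal_mono hsub).trans ((measureReal_union_le _ _).trans ?_)
    linarith [hle (c - t) (c - s) (by linarith), hle (c + s) (c + t) (by linarith)]

theorem isGrowthPiece_vertex (v : G.vertexSet) : IsGrowthPiece p.measure {.vertex v} where
  isClosed := p.isClosed_vertex v
  growth := by
    rintro _ rfl
    exact ⟨.singleton _ (p.isClosed_vertex v) (p.measure_vertex v)⟩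
  subsingleton_or := Or.inl Set.subsingleton_singleton

theorem measure_line_image_inter_pos (e : G.edgeSet) {a b : ℝ} (ha : 0 ≤ a) (hab : a < b)
    (hb : b ≤ 1) {U : Set p.Point} (hU : IsOpen U) (hne : (p.line e '' Set.Icc a b ∩ U).Nonempty) :
    0 < p.measure (p.line e '' Set.Icc a b ∩ U) := by
  obtain ⟨_, ⟨c, hc, rfl⟩, hcU⟩ := hne
  have hV : IsOpen (p.line e ⁻¹' U) := hU.preimage (p.continuous_line e)
  -- The given point may be an end of the segment, but it is a limit of interior ones.
  have hVne : (Set.Ioo a b ∩ p.line e ⁻¹' U).Nonempty := by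
    have hcl : c ∈ closure (Set.Ioo a b) := by rwa [closure_Ioo hab.ne]
    rw [Set.inter_comm]
    exact mem_closure_iff.1 hcl _ hV hcU
  have hpos : 0 < volume (Set.Ioo a b ∩ p.line e ⁻¹' U) :=
    (isOpen_Ioo.inter hV).measure_pos _ hVne
  have hm : MeasurableSet (p.line e '' Set.Icc a b ∩ U) :=
    (p.isClosed_line_image e (Set.Icc_subset_Icc ha hb) isClosed_Icc).measurableSet.inter
      hU.measurableSet
  rw [p.measure_apply hm]
  refine lt_of_lt_of_le (hpos.trans_le ?_) (ENNReal.le_tsum e)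
  rw [unitInterval.volume_apply]
  refine measure_mono fun t ht => ?_
  have ht' : t ∈ Set.Icc (0 : ℝ) 1 := ⟨ha.trans ht.1.1.le, ht.1.2.le.trans hb⟩
  refine ⟨⟨t, ht'⟩, ?_, rfl⟩
  rw [Set.mem_preimage, ← p.line_coe]
  exact ⟨⟨t, ⟨ht.1.1.le, ht.1.2.le⟩, rfl⟩, ht.2⟩

theorem isGrowthPiece_line_image (hE : G.edgeSet.Finite) (e : G.edgeSet) {K : Set ℝ}
    (hK : K ⊆ Set.Icc 0 1) (hc : IsClosed K) (ho : K.OrdConnected) :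
    IsGrowthPiece p.measure (p.line e '' K) := by
  rcases K.eq_empty_or_nonempty with rfl | hne
  · rw [Set.image_empty]
    exact ⟨isClosed_empty, by simp, Or.inl Set.subsingleton_empty⟩
  have hKc : IsCompact K := isCompact_Icc.of_isClosed_subset hc hK
  obtain ⟨a, b, rfl⟩ : ∃ a b, K = Set.Icc a b :=
    ⟨_, _, eq_Icc_of_connected_compact ⟨hne, ho.isPreconnected⟩ hKc⟩
  rw [Set.nonempty_Icc] at hne
  have ha := (hK (Set.left_mem_Icc.2 hne)).1
  have hb := (hK (Set.right_mem_Icc.2 hne)).2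
  refine ⟨p.isClosed_line_image e hK hc, ?_, ?_⟩
  · rintro _ ⟨c, hc, rfl⟩
    exact ⟨p.segmentGrowth hE e ha hb hc⟩
  · rcases hne.eq_or_lt with rfl | hab
    · exact Or.inl (by simp)
    · exact Or.inr fun U hU => p.measure_line_image_inter_pos e ha hab hb hU

/-! ### Structure of closed connected subsets -/

/-- A connected set meeting the interior of an edge between two points it avoids lies between these
points. -/
theorem subset_line_image_Ioo {L : Set p.Point} (hL : IsPreconnected L) {e : G.edgeSet}
    {s t s' : ℝ} (h0 : 0 ≤ s) (h1 : s' ≤ 1) (ht : t ∈ Set.Ioo s s') (hs : p.line e s ∉ L)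
    (hs' : p.line e s' ∉ L) (htL : p.line e t ∈ L) : L ⊆ p.line e '' Set.Ioo s s' := by
  refine hL.subset_left_of_subset_union (p.isOpen_line_image_Ioo e h0 h1)
    (p.isClosed_line_image e (Set.Icc_subset_Icc h0 h1) isClosed_Icc).isOpen_compl
    (Set.disjoint_compl_right_iff_subset.2 (Set.image_mono Set.Ioo_subset_Icc_self)) ?_
    ⟨_, htL, t, ht, rfl⟩
  intro z hz
  by_cases h : z ∈ p.line e '' Set.Icc s s'
  · obtain ⟨x, hx, rfl⟩ := h
    refine Or.inl ⟨x, ⟨lt_of_le_of_ne hx.1 ?_, lt_of_le_of_ne hx.2 ?_⟩, rfl⟩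
    · rintro rfl
      exact hs hz
    · rintro rfl
      exact hs' hz
  · exact Or.inr h

theorem exists_line_or_vertex (x : p.Point) :
    (∃ e, ∃ t ∈ Set.Icc (0 : ℝ) 1, x = p.line e t) ∨ ∃ v, x = .vertex v := by
  rcases x with v | ⟨e, t⟩
  · exact Or.inr ⟨v, rfl⟩
  · exact Or.inl ⟨e, t, ⟨t.2.1.le, t.2.2.le⟩, (p.line_of_mem_Ioo e t).symm⟩

/-- Closed connected subsets of a finite graph are finite unions of segments and vertices. -/
theorem exists_pieces (hV : G.vertexSet.Finite) (hE : G.edgeSet.Finite) {L : Set p.Point}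
    (hc : IsClosed L) (hL : IsPreconnected L) :
    ∃ F : Set (Set p.Point), F.Finite ∧ (∀ P ∈ F, IsGrowthPiece p.measure P) ∧ ⋃₀ F = L := by
  have hK : ∀ e, IsClosed (p.line e ⁻¹' L) := fun e => hc.preimage (p.continuous_line e)
  -- Either `L` is trapped between two missed interior points of one edge, and is then a single
  -- segment, or its trace on each edge is an initial segment `I₀` together with a final segment
  -- `I₁`.
  by_cases hA : ∃ (e : G.edgeSet) (s t s' : ℝ), 0 < s ∧ s' < 1 ∧ t ∈ Set.Ioo s s' ∧
      p.line e s ∉ L ∧ p.line e s' ∉ L ∧ p.line e t ∈ L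
  · obtain ⟨e, s, t, s', h0, h1, ht, hs, hs', htL⟩ := hA
    have hsub := p.subset_line_image_Ioo hL h0.le h1.le ht hs hs' htL
    have hKe : Set.Icc s s' ∩ p.line e ⁻¹' L ⊆ Set.Icc 0 1 :=
      Set.inter_subset_left.trans (Set.Icc_subset_Icc h0.le h1.le)
    refine ⟨{p.line e '' (Set.Icc s s' ∩ p.line e ⁻¹' L)}, Set.finite_singleton _, ?_, ?_⟩
    · rintro _ rfl
      refine p.isGrowthPiece_line_image hE e hKe (isClosed_Icc.inter (hK e)) ⟨?_⟩
      intro a ha b hb c hc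
      refine ⟨⟨ha.1.1.trans hc.1, hc.2.trans hb.1.2⟩, ?_⟩
      by_contra hcL
      have hac : a < c := lt_of_le_of_ne hc.1 (by rintro rfl; exact hcL ha.2)
      have hsa : s < a := lt_of_le_of_ne ha.1.1 (by rintro rfl; exact hs ha.2)
      have hcs : c ≤ s' := hc.2.trans hb.1.2
      have hbs : b < s' := lt_of_le_of_ne hb.1.2 (by rintro rfl; exact hs' hb.2)
      -- A missed point `c` would trap `L` between `s` and `c`, although `b` lies beyond `c`.
      obtain ⟨x, hx, hxb⟩ := p.subset_line_image_Ioo hL h0.le (hcs.trans h1.le)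
        ⟨hsa, hac⟩ hs hcL ha.2 hb.2
      have := (p.line_eq_line ⟨h0.trans hx.1, (hx.2.trans_le hcs).trans h1⟩ (hKe hb) hxb).2
      linarith [hx.2, hc.2]
    · rw [Set.sUnion_singleton]
      refine Set.Subset.antisymm ?_ ?_
      · rintro _ ⟨x, hx, rfl⟩
        exact hx.2
      · intro z hz
        obtain ⟨x, hx, rfl⟩ := hsub hz
        exact ⟨x, ⟨⟨hx.1.le, hx.2.le⟩, hz⟩, rfl⟩
  · let I₀ : G.edgeSet → Set ℝ := fun e => (Set.Icc 0 1 ∩ p.line e ⁻¹' L) ∩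
      ⋂ s ∈ {s | 0 < s ∧ p.line e s ∉ L}, Set.Iic s
    let I₁ : G.edgeSet → Set ℝ := fun e => (Set.Icc 0 1 ∩ p.line e ⁻¹' L) ∩
      ⋂ s ∈ {s | s < 1 ∧ p.line e s ∉ L}, Set.Ici s
    have := hE.to_subtype
    have := hV.to_subtype
    refine ⟨(Set.range fun e => p.line e '' I₀ e) ∪ (Set.range fun e => p.line e '' I₁ e) ∪
      -- Needed for vertices lying on no edge.
      (fun v => {.vertex v}) '' {v | .vertex v ∈ L},
      ((Set.finite_range _).union (Set.finite_range _)).union (Set.toFinite _), ?_, ?_⟩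
    · rintro _ ((⟨e, rfl⟩ | ⟨e, rfl⟩) | ⟨v, -, rfl⟩)
      · refine p.isGrowthPiece_line_image hE e
          (Set.inter_subset_left.trans Set.inter_subset_left)
          ((isClosed_Icc.inter (hK e)).inter (isClosed_biInter fun s _ => isClosed_Iic)) ⟨?_⟩
        intro a ha b hb c hc
        have hbI := Set.mem_iInter₂.1 hb.2
        refine ⟨⟨⟨ha.1.1.1.trans hc.1, hc.2.trans hb.1.1.2⟩, ?_⟩, Set.mem_iInter₂.2 fun s hs =>
          hc.2.trans (hbI s hs)⟩
        by_contra hcL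
        have hac : a < c := lt_of_le_of_ne hc.1 (by rintro rfl; exact hcL ha.1.2)
        have : b ≤ c := hbI c ⟨ha.1.1.1.trans_lt hac, hcL⟩
        obtain rfl := this.antisymm hc.2
        exact hcL hb.1.2
      · refine p.isGrowthPiece_line_image hE e
          (Set.inter_subset_left.trans Set.inter_subset_left)
          ((isClosed_Icc.inter (hK e)).inter (isClosed_biInter fun s _ => isClosed_Ici)) ⟨?_⟩
        intro a ha b hb c hc
        have haI := Set.mem_iInter₂.1 ha.2
        refine ⟨⟨⟨ha.1.1.1.trans hc.1, hc.2.trans hb.1.1.2⟩, ?_⟩, Set.mem_iInter₂.2 fun s hs =>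
          le_trans (haI s hs) hc.1⟩
        by_contra hcL
        have hcb : c < b := lt_of_le_of_ne hc.2 (by rintro rfl; exact hcL hb.1.2)
        have : c ≤ a := haI c ⟨hcb.trans_le hb.1.1.2, hcL⟩
        obtain rfl := this.antisymm hc.1
        exact hcL ha.1.2
      · exact p.isGrowthPiece_vertex v
    · refine Set.Subset.antisymm (Set.sUnion_subset ?_) fun z hz => ?_
      · rintro _ ((⟨e, rfl⟩ | ⟨e, rfl⟩) | ⟨v, hv, rfl⟩)
        · rintro _ ⟨x, hx, rfl⟩
          exact hx.1.2
        · rintro _ ⟨x, hx, rfl⟩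
          exact hx.1.2
        · rintro _ rfl
          exact hv
      · rcases p.exists_line_or_vertex z with ⟨e, t, ht, rfl⟩ | ⟨v, rfl⟩
        · by_cases h0 : ∀ s ∈ {s | 0 < s ∧ p.line e s ∉ L}, t ≤ s
          · exact ⟨_, Or.inl (Or.inl ⟨e, rfl⟩), t, ⟨⟨ht, hz⟩, Set.mem_iInter₂.2 h0⟩, rfl⟩
          by_cases h1 : ∀ s ∈ {s | s < 1 ∧ p.line e s ∉ L}, s ≤ t
          · exact ⟨_, Or.inl (Or.inr ⟨e, rfl⟩), t, ⟨⟨ht, hz⟩, Set.mem_iInter₂.2 h1⟩, rfl⟩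
          push Not at h0 h1
          obtain ⟨s, ⟨hs0, hsL⟩, hst⟩ := h0
          obtain ⟨s', ⟨hs1, hsL'⟩, hst'⟩ := h1
          exact absurd ⟨e, s, t, s', hs0, hs1, ⟨hst, hst'⟩, hsL, hsL', hz⟩ hA
        · exact ⟨_, Or.inr ⟨v, hz, rfl⟩, rfl⟩

end Graph.EdgeParam

/-! ### Propagation through a connected graph -/

namespace Graph.EdgeParam

variable {α β : Type*} {G : Graph α β} {p : G.EdgeParam} {r : ℝ}

/-- A property of points that propagates along each edge propagates everywhere in a connected
graph. -/
theorem forall_of_forall_line (hG : G.IsConn) {Q : p.Point → Prop}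
    (hQ : ∀ e, ∀ s ∈ Set.Icc (0 : ℝ) 1, ∀ t ∈ Set.Icc (0 : ℝ) 1,
      Q (p.line e s) → Q (p.line e t)) {x : p.Point} (hx : Q x) (y : p.Point) : Q y := by
  have h0 : (0 : ℝ) ∈ Set.Icc (0 : ℝ) 1 := ⟨le_rfl, zero_le_one⟩
  have h1 : (1 : ℝ) ∈ Set.Icc (0 : ℝ) 1 := ⟨zero_le_one, le_rfl⟩
  have hadj : ∀ v w : α, G.Adj v w → ∀ (hv : v ∈ G.vertexSet) (hw : w ∈ G.vertexSet),
      Q (.vertex ⟨v, hv⟩) → Q (.vertex ⟨w, hw⟩) := by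
    rintro v w ⟨e, he⟩ hv hw hQv
    have h01 := hQ ⟨e, he.edge_mem⟩ 0 h0 1 h1
    have h10 := hQ ⟨e, he.edge_mem⟩ 1 h1 0 h0
    rw [line_zero, line_one] at h01 h10
    rcases he.eq_and_eq_or_eq_and_eq (p.isLink ⟨e, he.edge_mem⟩) with ⟨h, h'⟩ | ⟨h, h'⟩
    · have hs : p.src _ = ⟨v, hv⟩ := Subtype.ext h.symm
      have ht : p.tgt _ = ⟨w, hw⟩ := Subtype.ext h'.symm
      exact ht ▸ h01 (hs ▸ hQv)
    · have hs : p.tgt _ = ⟨v, hv⟩ := Subtype.ext h.symm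
      have ht : p.src _ = ⟨w, hw⟩ := Subtype.ext h'.symm
      exact ht ▸ h10 (hs ▸ hQv)
  have hvw : ∀ v w : G.vertexSet, Q (.vertex v) → Q (.vertex w) := by
    intro v w hv
    have key : ∀ w, Relation.ReflTransGen G.Adj v w → ∀ hw : w ∈ G.vertexSet,
        Q (.vertex ⟨w, hw⟩) := by
      intro w h
      induction h with
      | refl => exact fun _ => hv
      | tail _ hbc ih => exact fun hc => hadj _ _ hbc hbc.left_mem hc (ih hbc.left_mem)
    exact key w (hG.2 v v.2 w w.2) w.2
  obtain ⟨v, hv⟩ : ∃ v, Q (.vertex v) := by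
    rcases p.exists_line_or_vertex x with ⟨e, t, ht, rfl⟩ | ⟨v, rfl⟩
    · exact ⟨p.src e, p.line_zero e ▸ hQ e t ht 0 h0 hx⟩
    · exact ⟨v, hx⟩
  rcases p.exists_line_or_vertex y with ⟨e, t, ht, rfl⟩ | ⟨w, rfl⟩
  · exact hQ e 0 h0 t ht (p.line_zero e ▸ hvw v _ hv)
  · exact hvw v w hv

theorem isPreconnected_univ_point (hG : G.IsConn) : IsPreconnected (Set.univ : Set p.Point) := by
  refine isPreconnected_of_forall_pair fun x _ y _ => ?_
  have h : y ∈ connectedComponent x := by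
    refine forall_of_forall_line hG (Q := (· ∈ connectedComponent x)) (fun e s _ t _ h => ?_)
      mem_connectedComponent y
    have hr := (isPreconnected_range (p.continuous_line e)).subset_connectedComponent
      (Set.mem_range_self s) (Set.mem_range_self t)
    rwa [← connectedComponent_eq h] at hr
  exact ⟨_, Set.subset_univ _, mem_connectedComponent, h, isPreconnected_connectedComponent⟩

theorem nonempty_growth (hV : G.vertexSet.Finite) (hE : G.edgeSet.Finite) {L : Set p.Point}
    (hc : IsClosed L) (hL : IsPreconnected L) {x : p.Point} (hx : x ∈ L) :
    Nonempty (Growth p.measure x L) := by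
  have := p.isFiniteMeasure_measure hE
  obtain ⟨F, hF, hp, rfl⟩ := p.exists_pieces hV hE hc hL
  exact nonempty_growth_sUnion hF hp hL hx

/-! ### The metric on X_r and its paths -/

namespace ConnSet

theorem carrier_injective : Function.Injective (carrier : p.ConnSet r → Set p.Point) := by
  rintro ⟨_, _, _, _⟩ ⟨_, _, _, _⟩ rfl
  rfl

/-- The overlap has full measure in `u`, so `u \ v` is null. Positivity of `r` excludes null sets
`u` such as single points, for which the conclusion can fail. -/
theorem subset_of_le_measure_inter (hV : G.vertexSet.Finite) (hE : G.edgeSet.Finite)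
    (hr : 0 < r) {u v : p.ConnSet r} (h : r ≤ p.measure.real (u.carrier ∩ v.carrier)) :
    u.carrier ⊆ v.carrier := by
  have := p.isFiniteMeasure_measure hE
  have hu : p.measure.real u.carrier = r := u.measure_eq
  have hpos : 0 < p.measure u.carrier := by
    rw [pos_iff_ne_zero]
    intro h0
    rw [measureReal_def, h0] at hu
    simp at hu
    linarith
  have h0 : p.measure (u.carrier \ v.carrier) = 0 := by
    rw [← measureReal_eq_zero_iff]
    have h1 := measureReal_sdiff_add_inter (μ := p.measure) (s := u.carrier)
      v.isClosed.measurableSet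
    exact le_antisymm (by linarith) measureReal_nonneg
  obtain ⟨F, hF, hp, hFu⟩ := p.exists_pieces hV hE u.isClosed u.isConnected.isPreconnected
  have hc := u.isConnected.isPreconnected
  rw [← hFu] at h0 hpos hc ⊢
  exact subset_of_measure_diff_eq_zero hF hp hc hpos v.isClosed h0

theorem eq_of_le_measure_inter (hV : G.vertexSet.Finite) (hE : G.edgeSet.Finite)
    (hr : 0 < r) {u v : p.ConnSet r} (h : r ≤ p.measure.real (u.carrier ∩ v.carrier)) : u = v :=
  carrier_injective ((subset_of_le_measure_inter hV hE hr h).antisymm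
    (subset_of_le_measure_inter hV hE hr (by rwa [Set.inter_comm])))

/-- The metric `d_G(u,v) = 2r - 2μ_G(u ∩ v)`. -/
noncomputable abbrev metricSpace (hV : G.vertexSet.Finite) (hE : G.edgeSet.Finite)
    (hr : 0 < r) : MetricSpace (p.ConnSet r) where
  dist u v := 2 * r - 2 * p.measure.real (u.carrier ∩ v.carrier)
  dist_self u := by rw [Set.inter_self, u.measure_eq, sub_self]
  dist_comm u v := by rw [Set.inter_comm]
  dist_triangle u v w := by
    have := p.isFiniteMeasure_measure hE
    -- Both `u ∩ v` and `v ∩ w` lie in `v`, so their measures add up to at most `r` plus that of `u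
    -- ∩ w`.
    have h1 := measureReal_union_add_inter (μ := p.measure) (s := u.carrier ∩ v.carrier)
      (v.isClosed.inter w.isClosed).measurableSet
    have h2 : p.measure.real (u.carrier ∩ v.carrier ∪ v.carrier ∩ w.carrier) ≤
        p.measure.real v.carrier :=
      measureReal_mono (Set.union_subset Set.inter_subset_right Set.inter_subset_left)
    have h3 : p.measure.real (u.carrier ∩ v.carrier ∩ (v.carrier ∩ w.carrier)) ≤
        p.measure.real (u.carrier ∩ w.carrier) :=
      measureReal_mono fun x hx => ⟨hx.1.1, hx.2.2⟩
    rw [v.measure_eq] at h2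
    linarith
  eq_of_dist_eq_zero {u v} h := eq_of_le_measure_inter hV hE hr (by
    change 2 * r - 2 * p.measure.real (u.carrier ∩ v.carrier) = 0 at h
    linarith)

/-- The connected set of measure `r` obtained by growing a smaller connected set. -/
theorem exists_eq_union (hE : G.edgeSet.Finite) {x : p.Point} {N S : Set p.Point}
    (A : Growth p.measure x S) (hN : IsClosed N) (hNc : IsPreconnected N) (hx : x ∈ N)
    (hNr : p.measure.real N ≤ r) (hS : r ≤ p.measure.real S) :
    ∃ t, ∃ u : p.ConnSet r, u.carrier = N ∪ A.toFun t := by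
  have := p.isFiniteMeasure_measure hE
  obtain ⟨t, ht⟩ := A.exists_measureReal_union_eq hNr hS
  exact ⟨t, ⟨_, hN.union (A.isClosed t), ⟨⟨x, Or.inl hx⟩, A.isPreconnected_union hNc hx t⟩, ht⟩,
    rfl⟩

/-- Two sets with a common point are joined by a path: let one shrink to this point while the other
one grows. -/
theorem joined_of_mem (hV : G.vertexSet.Finite) (hE : G.edgeSet.Finite) (hr : 0 < r)
    {u v : p.ConnSet r} {x : p.Point} (hu : x ∈ u.carrier) (hv : x ∈ v.carrier) :
    letI := metricSpace (p := p) hV hE hr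
    Joined u v := by
  let := metricSpace (p := p) hV hE hr
  have := p.isFiniteMeasure_measure hE
  obtain ⟨A⟩ := nonempty_growth hV hE u.isClosed u.isConnected.isPreconnected hu
  obtain ⟨B⟩ := nonempty_growth hV hE v.isClosed v.isConnected.isPreconnected hv
  -- The `max` keeps `x` in the first part, so the path is defined on all of `ℝ`. The choice of `t`
  -- may be arbitrary: the constraint on the measure alone forces continuity.
  have hex : ∀ s : ℝ, ∃ t, ∃ w : p.ConnSet r, w.carrier = A.toFun (max s 0) ∪ B.toFun t := fun s =>
    exists_eq_union hE B (A.isClosed _) (A.isPreconnected _) (A.mem _ (le_max_right _ _))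
      ((measureReal_mono (A.subset _)).trans_eq u.measure_eq) v.measure_eq.ge
  choose t w hw using hex
  have hdist : ∀ a b, a ≤ b → dist (w a) (w b) ≤ 2 * A.rate * (b - a) := by
    intro a b hab
    have hmax : max a 0 ≤ max b 0 := max_le_max_right 0 hab
    have hAab := A.mono hmax
    have hmb : max b 0 - max a 0 ≤ b - a := by
      rcases max_cases a 0 with ⟨h, _⟩ | ⟨h, _⟩ <;> rcases max_cases b 0 with ⟨h', _⟩ | ⟨h', _⟩ <;>
        linarith
    change 2 * r - 2 * p.measure.real ((w a).carrier ∩ (w b).carrier) ≤ _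
    have hkey : r - A.rate * (b - a) ≤ p.measure.real ((w a).carrier ∩ (w b).carrier) := by
      -- If `t` does not decrease, the sets are nested of equal measure. Otherwise the overlap
      -- contains `w b` except for what `A` gained between the two times.
      rcases le_total (t a) (t b) with h | h
      · have hsub : (w a).carrier ⊆ (w b).carrier := by
          rw [hw, hw]
          exact Set.union_subset_union hAab (B.mono h)
        rw [Set.inter_eq_left.2 hsub, (w a).measure_eq]
        nlinarith [mul_nonneg A.rate_nonneg (sub_nonneg.2 hab)]
      · have hsub : B.toFun (t b) ∪ A.toFun (max a 0) ⊆ (w a).carrier ∩ (w b).carrier := by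
          rw [hw, hw]
          exact Set.union_subset
            (Set.subset_inter (fun z hz => Or.inr (B.mono h hz)) Set.subset_union_right)
            (Set.subset_inter Set.subset_union_left fun z hz => Or.inl (hAab hz))
        have h1 := measureReal_mono (μ := p.measure) hsub
        have h2 := A.measureReal_union_le_add (B.toFun (t b)) hmax
        have h3 := (w b).measure_eq
        rw [hw, Set.union_comm] at h3
        have h4 := mul_le_mul_of_nonneg_left hmb A.rate_nonneg
        linarith
    linarith
  have hcont : Continuous w := by
    have hL : LipschitzWith (2 * A.rate).toNNReal w := by
      refine LipschitzWith.of_dist_le_mul fun a b => ?_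
      rw [Real.coe_toNNReal _ (by linarith [A.rate_nonneg]), Real.dist_eq]
      rcases le_total a b with h | h
      · rw [abs_sub_comm, abs_of_nonneg (sub_nonneg.2 h)]
        exact hdist a b h
      · rw [dist_comm, abs_of_nonneg (sub_nonneg.2 h)]
        exact hdist b a h
    exact hL.continuous
  -- At time 0 the part from `A` is null, so the part from `B`, inside `v`, has measure `r`.
  have h0 : w 0 = v := by
    refine eq_of_le_measure_inter hV hE hr ?_
    have h1 : B.toFun (t 0) ⊆ (w 0).carrier ∩ v.carrier :=
      Set.subset_inter (by rw [hw]; exact Set.subset_union_right) (B.subset _)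
    have h2 := measureReal_mono (μ := p.measure) h1
    have h3 := (w 0).measure_eq
    rw [hw, max_self] at h3
    have h4 := measureReal_union_le (μ := p.measure) (A.toFun 0) (B.toFun (t 0))
    rw [A.measureReal_toFun_zero] at h4
    linarith
  have h1 : w A.time = u := by
    refine (eq_of_le_measure_inter hV hE hr ?_).symm
    rw [Set.inter_eq_left.2, u.measure_eq]
    rw [hw]
    exact (A.subset_time.trans (A.mono (le_max_left _ _))).trans Set.subset_union_left
  rw [← h0, ← h1]
  exact (PathConnectedSpace.joined A.time 0).map hcont

/-- Closed connected sets of measure at most `r` extend to ones of measure `r`. -/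
theorem exists_superset (hV : G.vertexSet.Finite) (hE : G.edgeSet.Finite) (hG : G.IsConn)
    (hr' : r < (G.edgeSet.ncard : ℝ)) {N : Set p.Point} (hN : IsClosed N) (hNc : IsConnected N)
    (hNr : p.measure.real N ≤ r) : ∃ u : p.ConnSet r, N ⊆ u.carrier := by
  obtain ⟨x, hx⟩ := hNc.nonempty
  obtain ⟨A⟩ := nonempty_growth hV hE isClosed_univ (isPreconnected_univ_point hG)
    (Set.mem_univ x)
  obtain ⟨t, u, hu⟩ := exists_eq_union hE A hN hNc.isPreconnected hx hNr
    (by rw [p.measure_real_univ hE]; exact hr'.le)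
  exact ⟨u, hu ▸ Set.subset_union_left⟩

/-- The segment between the two points has measure at most `r`, so it extends to a member of X_r. -/
theorem exists_mem_mem (hV : G.vertexSet.Finite) (hE : G.edgeSet.Finite) (hG : G.IsConn)
    (hr' : r < (G.edgeSet.ncard : ℝ)) (e : G.edgeSet) {s t : ℝ} (hs : 0 ≤ s) (hst : s ≤ t)
    (ht : t ≤ 1) (hr : t - s ≤ r) :
    ∃ u : p.ConnSet r, p.line e s ∈ u.carrier ∧ p.line e t ∈ u.carrier := by
  obtain ⟨u, hu⟩ := exists_superset (p := p) hV hE hG hr'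
    (p.isClosed_line_image e (Set.Icc_subset_Icc hs ht) isClosed_Icc)
    ((isConnected_Icc hst).image _ (p.continuous_line e).continuousOn)
    ((ENNReal.toReal_le_of_le_ofReal (by linarith) (p.measure_line_image_Icc_le e hs ht)).trans hr)
  exact ⟨u, hu ⟨s, ⟨le_rfl, hst⟩, rfl⟩, hu ⟨t, ⟨hst, le_rfl⟩, rfl⟩⟩

theorem exists_mem (hV : G.vertexSet.Finite) (hE : G.edgeSet.Finite) (hG : G.IsConn)
    (hr : 0 < r) (hr' : r < (G.edgeSet.ncard : ℝ)) (x : p.Point) :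
    ∃ u : p.ConnSet r, x ∈ u.carrier := by
  rcases p.exists_line_or_vertex x with ⟨e, t, ht, rfl⟩ | ⟨v, rfl⟩
  · obtain ⟨u, hu, -⟩ := exists_mem_mem (p := p) hV hE hG hr' e ht.1 le_rfl ht.2
      (by simpa using hr.le)
    exact ⟨u, hu⟩
  · obtain ⟨u, hu⟩ := exists_superset (p := p) hV hE hG hr' (p.isClosed_vertex v)
      isConnected_singleton (by simpa [measureReal_def, p.measure_vertex] using hr.le)
    exact ⟨u, hu rfl⟩

theorem pathConnectedSpace (hV : G.vertexSet.Finite) (hE : G.edgeSet.Finite) (hG : G.IsConn)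
    (hr : 0 < r) (hr' : r < (G.edgeSet.ncard : ℝ)) :
    letI := metricSpace (p := p) hV hE hr
    PathConnectedSpace (p.ConnSet r) := by
  let := metricSpace (p := p) hV hE hr
  obtain ⟨v₀, hv₀⟩ := hG.1
  obtain ⟨u₀, -⟩ := exists_mem (p := p) hV hE hG hr hr' (.vertex ⟨v₀, hv₀⟩)
  refine ⟨⟨u₀⟩, fun u v => ?_⟩
  obtain ⟨x, hx⟩ := u.isConnected.nonempty
  obtain ⟨y, hy⟩ := v.isConnected.nonempty
  -- Quantifying over all members through `z` makes the property depend on `z` alone; it holds at `x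
  -- ∈ u` since sets with a common point are joined.
  refine forall_of_forall_line hG (Q := fun z => ∀ w : p.ConnSet r, z ∈ w.carrier → Joined u w) ?_
    (fun w hw => joined_of_mem hV hE hr hx hw) y v hy
  intro e
  have hstep : ∀ s ∈ Set.Icc (0 : ℝ) 1, ∀ t ∈ Set.Icc (0 : ℝ) 1, |s - t| ≤ r →
      (∀ w : p.ConnSet r, p.line e s ∈ w.carrier → Joined u w) →
      ∀ w : p.ConnSet r, p.line e t ∈ w.carrier → Joined u w := by
    intro s hs t ht hst h w hw
    obtain ⟨w', hs', ht'⟩ : ∃ w' : p.ConnSet r, p.line e s ∈ w'.carrier ∧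
        p.line e t ∈ w'.carrier := by
      rw [abs_le] at hst
      rcases le_total s t with hle | hle
      · exact exists_mem_mem hV hE hG hr' e hs.1 hle ht.2 (by linarith)
      · obtain ⟨w', h1, h2⟩ := exists_mem_mem (p := p) hV hE hG hr' e ht.1 hle hs.2 (by linarith)
        exact ⟨w', h2, h1⟩
    exact (h w' hs').trans (joined_of_mem hV hE hr ht' hw)
  intro s hs t ht h
  -- Cut the way from `s` to `t` into `n` steps of length less than `r`.
  obtain ⟨n, hn⟩ := exists_nat_gt (|t - s| / r)
  have hn0 : (0 : ℝ) < n := (div_nonneg (abs_nonneg _) hr.le).trans_lt hn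
  have key : ∀ k : ℕ, k ≤ n → ∀ w : p.ConnSet r, p.line e (s + k / n * (t - s)) ∈ w.carrier →
      Joined u w := by
    have hmem : ∀ k : ℕ, k ≤ n → s + k / n * (t - s) ∈ Set.Icc (0 : ℝ) 1 := by
      intro k hk
      refine (convex_Icc (0 : ℝ) 1).add_smul_sub_mem hs ht (t := (k : ℝ) / n) ⟨by positivity, ?_⟩
      rw [div_le_one hn0]
      exact_mod_cast hk
    intro k
    induction k with
    | zero => simpa using h
    | succ k ih =>
      intro hk
      refine hstep _ (hmem k (by omega)) _ (hmem (k + 1) hk) ?_ (ih (by omega))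
      have heq : s + (k : ℝ) / n * (t - s) - (s + ((k + 1 : ℕ) : ℝ) / n * (t - s)) =
          -((t - s) / n) := by
        push_cast
        field_simp
        ring
      rw [heq, abs_neg, abs_div, abs_of_pos hn0, div_le_iff₀ hn0]
      rw [div_lt_iff₀ hr] at hn
      linarith
  have := key n le_rfl
  rwa [div_self hn0.ne', one_mul, add_sub_cancel] at this

end ConnSet

end Graph.EdgeParam

theorem theorem2 {α β : Type*} (G : Graph α β) (hV : G.vertexSet.Finite) (hE : G.edgeSet.Finite)
    (hG : G.IsConn) (p : G.EdgeParam) (r : ℝ) (hr : 0 < r) (hr' : r < (G.edgeSet.ncard : ℝ)) :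
    ∃ _m : MetricSpace (p.ConnSet r),
      (∀ u v : p.ConnSet r, dist u v = 2 * r - 2 * p.measure.real (u.carrier ∩ v.carrier)) ∧
      PathConnectedSpace (p.ConnSet r) :=
  ⟨Graph.EdgeParam.ConnSet.metricSpace hV hE hr, fun _ _ => rfl,
    Graph.EdgeParam.ConnSet.pathConnectedSpace hV hE hG hr hr'⟩
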